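/- For every $\delta>0$ there is a threshold $n_0=n_0(\delta)$ such that the following holds for all $n\ge n_0$. Let $A,B,C\subset\mathbb{R}^2$ be $n$-point sets that are mutually avoiding, that is, no line through two distinct points of one of the sets meets the convex hull of either of the other two sets. Let $T$ be any family of at least $\delta n^2$ collinear triples $(a,b,c)$ with $a\in A$, $b\in B$, $c\in C$ (for instance, if there are at least $\delta n^2$ such triples, the family of all of them). Then $T$ contains nine triples whose points form a set of exactly $12$ points (a $(12,9)$ configuration), and among these nine triples there is a tic-tac-toe configuration: there are nine distinct points $p_{ij}$ ($1\le i,j\le 3$) such that each of the three rows $\{p_{i1},p_{i2},p_{i3}\}$ and each of the three columns $\{p_{1j},p_{2j},p_{3j}\}$ is the point set of one of the nine triples. In particular, $T$ contains a tic-tac-toe configuration. -/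

import Mathlib

/-- The Euclidean plane. -/
abbrev Plane : Type := EuclideanSpace ℝ (Fin 2)

/-- `P` avoids `Q`: no line determined by two (distinct) points of `P` meets the convex hull
of `Q`. -/
def Avoids (P Q : Set Plane) : Prop :=
  ∀ p ∈ P, ∀ q ∈ P, p ≠ q →
    Disjoint (affineSpan ℝ {p, q} : Set Plane) (convexHull ℝ Q)

/-- Three point sets are mutually avoiding: no line determined by two points of one of the sets
meets the convex hull of either of the other two. -/
def MutuallyAvoiding (A B C : Set Plane) : Prop :=
  (Avoids A B ∧ Avoids A C) ∧ (Avoids B A ∧ Avoids B C) ∧ (Avoids C A ∧ Avoids C B)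

open Classical in
/-- The hypergraph edge (vertex set) `{a, b, c}` of an ordered triple `(a, b, c)`. -/
noncomputable def edgeOf {V : Type*} (t : V × V × V) : Finset V :=
  {t.1, t.2.1, t.2.2}

open Classical in
/-- The set of all vertices occurring in the triples of a family. -/
noncomputable def verticesOf {V : Type*} (S : Finset (V × V × V)) : Finset V :=
  S.biUnion edgeOf

open Classical in
/-- A family `S` of triples contains a tic-tac-toe: there are nine distinct vertices `p i j`,
arranged on a 3 × 3 board, such that the three rows and the three columns of the board are
(the vertex sets of) triples of `S`. -/
def ContainsTicTacToe {V : Type*} (S : Finset (V × V × V)) : Prop :=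
  ∃ p : Fin 3 → Fin 3 → V,
    Function.Injective2 p ∧
    (∀ i, ∃ t ∈ S, edgeOf t = {p i 0, p i 1, p i 2}) ∧
    (∀ j, ∃ t ∈ S, edgeOf t = {p 0 j, p 1 j, p 2 j})

/-! The proof applies the (6,3) theorem twice, at two scales. By mutual avoidance the collinear
triples form a linear system: two of the points determine the third. Each triple has a middle point,
so a third of the triples may be taken to have it in `C`. Seen from another of the sets, the points
of each set are linearly ordered by direction, independently of the viewpoint. With suitable signs
for these orders, no triple is strictly below another in all three coordinates
(`not_orient_of_sbtw`).

This turns the problem into one about integer triples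
(`containsTriangleProduct_of_no_strict_chain`). Cut the cube into blocks of constant side `K`. The
occupied blocks again contain no strict chain, so there are only `O(m²)` of them among `m³`, and
many are dense enough to contain a triangle. Pigeonhole fixes its position inside the block. The
blocks sharing this position form a dense linear system, which contains a triangle of blocks. The
result is a product of two triangles: nine triples on twelve points, six of which form a
tic-tac-toe. -/

/-! ### The (6,3) theorem. -/

open Finset SimpleGraph TripartiteFromTriangles in
/-- The **Ruzsa–Szemerédi (6,3) theorem** for tripartite linear systems of triples. -/
theorem exists_triangle_of_explicitDisjoint {δ : ℝ} (hδ : 0 < δ) :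
    ∃ N : ℕ, ∀ n, N ≤ n → ∀ E : Finset (Fin n × Fin n × Fin n), ExplicitDisjoint E →
      δ * (n : ℝ) ^ 2 ≤ #E →
      ∃ a a' b b' c c', (a', b, c) ∈ E ∧ (a, b', c) ∈ E ∧ (a, b, c') ∈ E ∧
        a ≠ a' ∧ b ≠ b' ∧ c ≠ c' := by
  -- The graph has `3n` vertices, whence `9 = 3²` and `27 = 3³`. Without accidental triangles it has
  -- exactly `#E ≤ n²` triangles, while triangle removal forces a constant times `n³`.
  refine ⟨⌊(triangleRemovalBound (δ / 9) * 27)⁻¹⌋₊ + 1, fun n hn E hE hcard ↦ ?_⟩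
  by_contra! h
  have hpos : 0 < triangleRemovalBound (δ / 9) := triangleRemovalBound_pos (by positivity)
  have : NoAccidental E := ⟨fun a a' b b' c c' h₁ h₂ h₃ ↦ by
    by_contra! hne
    exact hne.2.2 (h a a' b b' c c' h₁ h₂ h₃ hne.1 hne.2.1)⟩
  have hfar : (graph E).FarFromTriangleFree (δ / 9) := by
    refine farFromTriangleFree _ ?_
    simp only [Fintype.card_fin]
    push_cast
    linarith
  have h₁ := hfar.le_card_cliqueFinset
  rw [card_triangles] at h₁
  have h₂ : #E ≤ n ^ 2 := by
    calc #E ≤ #(univ : Finset (Fin n × Fin n)) := by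
          refine card_le_card_of_injOn (fun t ↦ (t.1, t.2.1)) (by simp) ?_
          rintro ⟨a, b, c⟩ ht ⟨a', b', c'⟩ ht' heq
          simp only [Prod.mk.injEq] at heq
          obtain ⟨rfl, rfl⟩ := heq
          rw [hE.inj₂ ht ht']
      _ = n ^ 2 := by simp [sq]
  have h₂' : (#E : ℝ) ≤ (n : ℝ) ^ 2 := by exact_mod_cast h₂
  have hn' : (triangleRemovalBound (δ / 9) * 27)⁻¹ < n :=
    (Nat.lt_floor_add_one _).trans_le (by exact_mod_cast hn)
  rw [inv_lt_iff_one_lt_mul₀' (by positivity)] at hn'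
  have hn0 : 0 < (n : ℝ) := by
    have : 0 < n := by omega
    exact_mod_cast this
  have h₃ : triangleRemovalBound (δ / 9) * 27 * n * (n : ℝ) ^ 2 ≤ 1 * (n : ℝ) ^ 2 := by
    refine le_trans (le_of_eq ?_) ((h₁.trans h₂').trans_eq (one_mul _).symm)
    simp only [Fintype.card_sum, Fintype.card_fin]
    push_cast
    ring
  exact hn'.not_ge (le_of_mul_le_mul_right h₃ (by positivity))

open Finset SimpleGraph TripartiteFromTriangles in
/-- The **Ruzsa–Szemerédi (6,3) theorem** for linear systems of triples of natural numbers. -/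
theorem exists_triangle_of_explicitDisjoint_nat {δ : ℝ} (hδ : 0 < δ) :
    ∃ N : ℕ, ∀ n, N ≤ n → ∀ E : Finset (ℕ × ℕ × ℕ),
      E ⊆ range n ×ˢ range n ×ˢ range n → ExplicitDisjoint E → δ * (n : ℝ) ^ 2 ≤ #E →
      ∃ a a' b b' c c', (a', b, c) ∈ E ∧ (a, b', c) ∈ E ∧ (a, b, c') ∈ E ∧
        a ≠ a' ∧ b ≠ b' ∧ c ≠ c' := by
  obtain ⟨N, hN⟩ := exists_triangle_of_explicitDisjoint hδ
  refine ⟨N, fun n hn E hE hdisj hcard ↦ ?_⟩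
  set F : Finset (Fin n × Fin n × Fin n) :=
    univ.filter fun t ↦ ((t.1 : ℕ), (t.2.1 : ℕ), (t.2.2 : ℕ)) ∈ E with hF
  have hmem (a b c : Fin n) : (a, b, c) ∈ F ↔ ((a : ℕ), (b : ℕ), (c : ℕ)) ∈ E := by simp [hF]
  have hdF : ExplicitDisjoint F :=
    ⟨fun a b c a' h h' ↦ Fin.ext (hdisj.inj₀ ((hmem ..).1 h) ((hmem ..).1 h')),
      fun a b c b' h h' ↦ Fin.ext (hdisj.inj₁ ((hmem ..).1 h) ((hmem ..).1 h')),
      fun a b c c' h h' ↦ Fin.ext (hdisj.inj₂ ((hmem ..).1 h) ((hmem ..).1 h'))⟩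
  have hle : #E ≤ #F := by
    refine card_le_card_of_surjOn (fun t ↦ ((t.1 : ℕ), (t.2.1 : ℕ), (t.2.2 : ℕ))) ?_
    rintro ⟨a, b, c⟩ ht
    have := hE ht
    simp only [mem_product, mem_range] at this
    exact ⟨(⟨a, this.1⟩, ⟨b, this.2.1⟩, ⟨c, this.2.2⟩), by simpa [hF] using ht, rfl⟩
  obtain ⟨a, a', b, b', c, c', h₁, h₂, h₃, ha, hb, hc⟩ :=
    hN n hn F hdF (hcard.trans (by exact_mod_cast hle))
  exact ⟨a, a', b, b', c, c', (hmem ..).1 h₁, (hmem ..).1 h₂, (hmem ..).1 h₃,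
    fun h ↦ ha (Fin.ext h), fun h ↦ hb (Fin.ext h), fun h ↦ hc (Fin.ext h)⟩

/-! ### Products of triangles in systems without strict chains. -/

/-- `T` contains the product of two triangles (linear three-edge cycles): two levels of
coordinates, each of which runs through the edges `(1, 0, 0)`, `(0, 1, 0)`, `(0, 0, 1)`. -/
def ContainsTriangleProduct {α β γ : Type*} (T : Finset (α × β × γ)) : Prop :=
  ∃ (a : Fin 2 → Fin 2 → α) (b : Fin 2 → Fin 2 → β) (c : Fin 2 → Fin 2 → γ),
    (Function.Injective2 a ∧ Function.Injective2 b ∧ Function.Injective2 c) ∧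
    ∀ s t : Fin 3, (a (if s = 0 then 1 else 0) (if t = 0 then 1 else 0),
      b (if s = 1 then 1 else 0) (if t = 1 then 1 else 0),
      c (if s = 2 then 1 else 0) (if t = 2 then 1 else 0)) ∈ T

open Finset in
/-- A set of triples no two of which are strictly comparable is a surface: it has at most `3 m²`
elements. -/
theorem card_le_of_no_strict_chain {m : ℕ} {Q : Finset (ℕ × ℕ × ℕ)}
    (hQ : Q ⊆ range m ×ˢ range m ×ˢ range m)
    (hchain : ∀ s ∈ Q, ∀ t ∈ Q, ¬ (s.1 < t.1 ∧ s.2.1 < t.2.1 ∧ s.2.2 < t.2.2)) :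
    #Q ≤ 3 * m ^ 2 := by
  set P₀ : Finset (ℕ × ℕ × ℕ) := {0} ×ˢ range m ×ˢ range m
  set P₁ : Finset (ℕ × ℕ × ℕ) := range m ×ˢ {0} ×ˢ range m
  set P₂ : Finset (ℕ × ℕ × ℕ) := range m ×ˢ range m ×ˢ {0}
  have hP : #(P₀ ∪ P₁ ∪ P₂) ≤ 3 * m ^ 2 := by
    calc #(P₀ ∪ P₁ ∪ P₂) ≤ #P₀ + #P₁ + #P₂ :=
          (card_union_le _ _).trans (Nat.add_le_add_right (card_union_le _ _) _)
      _ = 3 * m ^ 2 := by simp [P₀, P₁, P₂, card_product]; ring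
  -- Project along the direction `(1, 1, 1)` onto the coordinate faces; distinct triples on one
  -- diagonal would be strictly comparable.
  refine (card_le_card_of_injOn (fun t ↦ (t.1 - min t.1 (min t.2.1 t.2.2),
    t.2.1 - min t.1 (min t.2.1 t.2.2), t.2.2 - min t.1 (min t.2.1 t.2.2))) ?_ ?_).trans hP
  · rintro ⟨a, b, c⟩ ht
    have := hQ ht
    simp only [mem_product, mem_range] at this
    simp only [P₀, P₁, P₂, coe_union, Set.mem_union, mem_coe, mem_product, mem_singleton, mem_range]
    omega
  · rintro ⟨a, b, c⟩ ht ⟨a', b', c'⟩ ht' heq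
    have h₁ := hchain _ ht _ ht'
    have h₂ := hchain _ ht' _ ht
    simp only [Prod.mk.injEq] at heq h₁ h₂ ⊢
    omega

open Finset SimpleGraph TripartiteFromTriangles in
theorem card_le_sq_of_explicitDisjoint {K : ℕ} {E : Finset (ℕ × ℕ × ℕ)}
    (hE : E ⊆ range K ×ˢ range K ×ˢ range K) (hdisj : ExplicitDisjoint E) : #E ≤ K ^ 2 := by
  calc #E ≤ #(range K ×ˢ range K) := by
        refine card_le_card_of_injOn (fun t ↦ (t.1, t.2.1)) ?_ ?_
        · rintro t ht
          have := hE ht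
          simp only [mem_product] at this
          simp only [mem_coe, mem_product]
          exact ⟨this.1, this.2.1⟩
        · rintro ⟨a, b, c⟩ ht ⟨a', b', c'⟩ ht' heq
          simp only [Prod.mk.injEq] at heq
          obtain ⟨rfl, rfl⟩ := heq
          rw [hdisj.inj₂ ht ht']
    _ = K ^ 2 := by simp [sq]

theorem injective2_mul_add {K i i' x x' : ℕ} (hi : i ≠ i') (hx : x ≠ x') (hxK : x < K)
    (hxK' : x' < K) :
    Function.Injective2 fun p q : Fin 2 ↦
      K * (if p = 1 then i' else i) + (if q = 1 then x' else x) := by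
  have key {u u' v v' : ℕ} (hv : v < K) (hv' : v' < K) (h : K * u + v = K * u' + v') :
      u = u' ∧ v = v' := by
    have h₁ := congrArg (· / K) h
    have h₂ := congrArg (· % K) h
    simp only [Nat.mul_add_mod, Nat.mod_eq_of_lt hv, Nat.mod_eq_of_lt hv'] at h₂
    simp only [Nat.mul_add_div (by omega : 0 < K), Nat.div_eq_of_lt hv, Nat.div_eq_of_lt hv',
      add_zero] at h₁
    exact ⟨h₁, h₂⟩
  intro p p' q q' h
  have hb (q : Fin 2) : (if q = 1 then x' else x) < K := by split_ifs <;> assumption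
  obtain ⟨h₁, h₂⟩ := key (hb q) (hb q') h
  fin_cases p <;> fin_cases p' <;> fin_cases q <;> fin_cases q' <;> simp_all

open Finset SimpleGraph TripartiteFromTriangles in
/-- A dense linear system of triples of natural numbers with no two strictly comparable triples
contains a product of two triangles. -/
theorem containsTriangleProduct_of_no_strict_chain {δ : ℝ} (hδ : 0 < δ) :
    ∃ N : ℕ, ∀ n, N ≤ n → ∀ T : Finset (ℕ × ℕ × ℕ),
      T ⊆ range n ×ˢ range n ×ˢ range n → ExplicitDisjoint T →
      (∀ s ∈ T, ∀ t ∈ T, ¬ (s.1 < t.1 ∧ s.2.1 < t.2.1 ∧ s.2.2 < t.2.2)) →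
      δ * (n : ℝ) ^ 2 ≤ #T → ContainsTriangleProduct T := by
  obtain ⟨N₁, hN₁⟩ := exists_triangle_of_explicitDisjoint_nat (δ := δ / 24) (by positivity)
  set K := max N₁ 1 with hK
  have hK0 : 0 < K := by omega
  have hKR : (0 : ℝ) < K := by exact_mod_cast hK0
  obtain ⟨N₂, hN₂⟩ := exists_triangle_of_explicitDisjoint_nat (δ := δ / (8 * K ^ 6))
    (by positivity)
  refine ⟨K * (N₂ + 1), fun n hn T hT hdisj hchain hcard ↦ ?_⟩
  -- The number of blocks per axis, rounded up; `K ≤ n` keeps `m * K ≤ 2 * n`.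
  set m := n / K + 1 with hm
  have hN₂m : N₂ ≤ m := by
    have : N₂ + 1 ≤ n / K := (Nat.le_div_iff_mul_le hK0).2 (by linarith)
    omega
  have hmn : (m : ℝ) * K ≤ 2 * n := by
    have h₁ : n / K * K ≤ n := Nat.div_mul_le_self n K
    have h₂ : K ≤ n := le_trans (Nat.le_mul_of_pos_right K (Nat.succ_pos N₂)) hn
    have : m * K ≤ 2 * n := by rw [hm, add_mul, one_mul]; omega
    exact_mod_cast this
  -- the block of a triple, and the part of `T` in a block
  let blk : ℕ × ℕ × ℕ → ℕ × ℕ × ℕ := fun t ↦ (t.1 / K, t.2.1 / K, t.2.2 / K)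
  let loc : ℕ × ℕ × ℕ → Finset (ℕ × ℕ × ℕ) := fun q ↦
    (range K ×ˢ range K ×ˢ range K).filter fun u ↦
      (K * q.1 + u.1, K * q.2.1 + u.2.1, K * q.2.2 + u.2.2) ∈ T
  set Q := T.image blk with hQ
  have hQm : Q ⊆ range m ×ˢ range m ×ˢ range m := by
    intro q hq
    obtain ⟨t, ht, rfl⟩ := mem_image.1 hq
    have := hT ht
    simp only [mem_product, mem_range] at this
    simp only [blk, mem_product, mem_range, hm, Nat.lt_succ_iff]
    exact ⟨Nat.div_le_div_right this.1.le, Nat.div_le_div_right this.2.1.le,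
      Nat.div_le_div_right this.2.2.le⟩
  have hQcard : #Q ≤ 3 * m ^ 2 := by
    refine card_le_of_no_strict_chain hQm ?_
    intro q hq q' hq'
    obtain ⟨t, ht, rfl⟩ := mem_image.1 hq
    obtain ⟨t', ht', rfl⟩ := mem_image.1 hq'
    rintro ⟨h₁, h₂, h₃⟩
    exact hchain t ht t' ht' ⟨Nat.lt_of_div_lt_div h₁, Nat.lt_of_div_lt_div h₂,
      Nat.lt_of_div_lt_div h₃⟩
  have hlocdisj (q) : ExplicitDisjoint (loc q) := by
    refine ⟨?_, ?_, ?_⟩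
    · intro a b c a' h h'
      simp only [loc, mem_filter] at h h'
      have := hdisj.inj₀ h.2 h'.2
      omega
    · intro a b c a' h h'
      simp only [loc, mem_filter] at h h'
      have := hdisj.inj₁ h.2 h'.2
      omega
    · intro a b c a' h h'
      simp only [loc, mem_filter] at h h'
      have := hdisj.inj₂ h.2 h'.2
      omega
  have hlocK (q) : #(loc q) ≤ K ^ 2 :=
    card_le_sq_of_explicitDisjoint (filter_subset _ _) (hlocdisj q)
  have hfib (q) : #(T.filter fun t ↦ blk t = q) ≤ #(loc q) := by
    refine card_le_card_of_injOn (fun t ↦ (t.1 % K, t.2.1 % K, t.2.2 % K)) ?_ ?_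
    · rintro t ht
      obtain ⟨htT, rfl⟩ := mem_filter.1 ht
      simp only [loc, blk, coe_filter, mem_product, mem_range, Set.mem_ofPred_eq, Nat.div_add_mod]
      exact ⟨⟨Nat.mod_lt _ hK0, Nat.mod_lt _ hK0, Nat.mod_lt _ hK0⟩, htT⟩
    · rintro ⟨a, b, c⟩ ht ⟨a', b', c'⟩ ht' heq
      have ht := (mem_filter.1 ht).2
      have ht' := (mem_filter.1 ht').2
      rw [← ht'] at ht
      simp only [blk, Prod.mk.injEq] at ht heq ⊢
      refine ⟨?_, ?_, ?_⟩
      · rw [← Nat.div_add_mod a K, ← Nat.div_add_mod a' K, ht.1, heq.1]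
      · rw [← Nat.div_add_mod b K, ← Nat.div_add_mod b' K, ht.2.1, heq.2.1]
      · rw [← Nat.div_add_mod c K, ← Nat.div_add_mod c' K, ht.2.2, heq.2.2]
  -- many blocks are dense
  set H := Q.filter fun q ↦ δ / 24 * (K : ℝ) ^ 2 ≤ #(loc q) with hH
  have hsum : (#T : ℝ) ≤ #H * (K : ℝ) ^ 2 + (3 * (m : ℝ) ^ 2) * (δ / 24 * (K : ℝ) ^ 2) := by
    have h₁ : #T = ∑ q ∈ Q, #(T.filter fun t ↦ blk t = q) :=
      card_eq_sum_card_fiberwise fun t ht ↦ mem_image_of_mem _ ht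
    have h₂ : #T ≤ ∑ q ∈ Q, #(loc q) := h₁.le.trans (sum_le_sum fun q _ ↦ hfib q)
    have h₃ : (#T : ℝ) ≤ ∑ q ∈ Q, (#(loc q) : ℝ) := by exact_mod_cast h₂
    refine h₃.trans ?_
    rw [← sum_filter_add_sum_filter_not Q fun q ↦ δ / 24 * (K : ℝ) ^ 2 ≤ #(loc q)]
    refine add_le_add ?_ ?_
    · rw [← nsmul_eq_mul]
      exact sum_le_card_nsmul _ _ _ fun q _ ↦ by exact_mod_cast hlocK q
    · calc _ ≤ #(Q.filter fun q ↦ ¬ δ / 24 * (K : ℝ) ^ 2 ≤ #(loc q)) • (δ / 24 * (K : ℝ) ^ 2) :=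
            sum_le_card_nsmul _ _ _ fun q hq ↦ (not_le.1 (mem_filter.1 hq).2).le
        _ ≤ _ := by
            rw [nsmul_eq_mul]
            gcongr
            exact_mod_cast (card_filter_le _ _).trans hQcard
  have hHcard : δ / 8 * (m : ℝ) ^ 2 ≤ #H := by
    have h₁ : ((m : ℝ) * K) ^ 2 ≤ (2 * n) ^ 2 := by gcongr
    have h₂ : δ * ((m : ℝ) * K) ^ 2 ≤ δ * (2 * n) ^ 2 := by gcongr
    have h₃ : δ / 8 * (m : ℝ) ^ 2 * (K : ℝ) ^ 2 ≤ #H * (K : ℝ) ^ 2 := by nlinarith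
    exact le_of_mul_le_mul_right h₃ (by positivity)
  -- every dense block contains a triangle
  have htri : ∀ q ∈ H, ∃ p : (ℕ × ℕ × ℕ) × (ℕ × ℕ × ℕ),
      p ∈ (range K ×ˢ range K ×ˢ range K) ×ˢ (range K ×ˢ range K ×ˢ range K) ∧
      ((p.2.1, p.1.2.1, p.1.2.2) ∈ loc q ∧ (p.1.1, p.2.2.1, p.1.2.2) ∈ loc q ∧
        (p.1.1, p.1.2.1, p.2.2.2) ∈ loc q) ∧
      p.1.1 ≠ p.2.1 ∧ p.1.2.1 ≠ p.2.2.1 ∧ p.1.2.2 ≠ p.2.2.2 := by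
    intro q hq
    obtain ⟨x, x', y, y', z, z', h₁, h₂, h₃, hx, hy, hz⟩ :=
      hN₁ K (le_max_left _ _) (loc q) (filter_subset _ _) (hlocdisj q) (mem_filter.1 hq).2
    refine ⟨((x, y, z), (x', y', z')), ?_, ⟨h₁, h₂, h₃⟩, hx, hy, hz⟩
    simp only [loc, mem_filter, mem_product] at h₁ h₂ h₃ ⊢
    tauto
  choose! pat hpat₁ hpat₂ hpat₃ using htri
  set W := (range K ×ˢ range K ×ˢ range K) ×ˢ (range K ×ˢ range K ×ˢ range K) with hW
  have hWcard : #W = K ^ 6 := by simp [hW]; ring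
  obtain ⟨p, hpW, hp⟩ : ∃ p ∈ W, δ / (8 * K ^ 6) * (m : ℝ) ^ 2 ≤ #(H.filter fun q ↦ pat q = p) := by
    refine exists_le_card_fiber_of_nsmul_le_card_of_maps_to (M := ℝ) hpat₁ ?_ ?_
    · rw [← card_pos, hWcard]
      positivity
    · rw [hWcard, nsmul_eq_mul]
      refine le_trans (le_of_eq ?_) hHcard
      push_cast
      field_simp
  obtain ⟨⟨x, y, z⟩, ⟨x', y', z'⟩⟩ := p
  set E := H.filter fun q ↦ pat q = ((x, y, z), (x', y', z')) with hE
  have hEsub : E ⊆ range m ×ˢ range m ×ˢ range m :=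
    (filter_subset _ _).trans ((filter_subset _ _).trans hQm)
  have hEmem : ∀ q ∈ E, ((K * q.1 + x', K * q.2.1 + y, K * q.2.2 + z) ∈ T ∧
      (K * q.1 + x, K * q.2.1 + y', K * q.2.2 + z) ∈ T ∧
      (K * q.1 + x, K * q.2.1 + y, K * q.2.2 + z') ∈ T) ∧ x ≠ x' ∧ y ≠ y' ∧ z ≠ z' := by
    intro q hq
    obtain ⟨hqH, hq⟩ := mem_filter.1 hq
    have h₂ := hpat₂ q hqH
    have h₃ := hpat₃ q hqH
    rw [hq] at h₂ h₃
    exact ⟨⟨(mem_filter.1 h₂.1).2, (mem_filter.1 h₂.2.1).2, (mem_filter.1 h₂.2.2).2⟩, h₃⟩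
  -- All blocks of `E` contain a triple of `T` at the same offset, so linearity of `T` passes to the
  -- block indices.
  have hEdisj : ExplicitDisjoint E := by
    have hcancel {u v w : ℕ} (h : K * u + w = K * v + w) : u = v :=
      Nat.eq_of_mul_eq_mul_left hK0 (Nat.add_right_cancel h)
    refine ⟨fun a b c a' h h' ↦ ?_, fun a b c b' h h' ↦ ?_, fun a b c c' h h' ↦ ?_⟩
    · exact hcancel (hdisj.inj₀ (hEmem _ h).1.1 (hEmem _ h').1.1)
    · exact hcancel (hdisj.inj₁ (hEmem _ h).1.1 (hEmem _ h').1.1)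
    · exact hcancel (hdisj.inj₂ (hEmem _ h).1.1 (hEmem _ h').1.1)
  obtain ⟨i, i', j, j', k, k', h₁, h₂, h₃, hi, hj, hk⟩ := hN₂ m hN₂m E hEsub hEdisj hp
  obtain ⟨h₁, hx, hy, hz⟩ := hEmem _ h₁
  have h₂ := (hEmem _ h₂).1
  have h₃ := (hEmem _ h₃).1
  simp only [hW, mem_product, mem_range] at hpW
  refine ⟨_, _, _, ⟨injective2_mul_add hi hx hpW.1.1 hpW.2.1,
    injective2_mul_add hj hy hpW.1.2.1 hpW.2.2.1,
    injective2_mul_add hk hz hpW.1.2.2 hpW.2.2.2⟩, fun s t ↦ ?_⟩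
  fin_cases s <;> fin_cases t <;> simp [h₁, h₂, h₃]

/-! ### Orientation and directional orders of avoiding sets. -/

/-- Twice the signed area of the triangle `x y z`. -/
noncomputable def orient (x y z : Plane) : ℝ :=
  (y 0 - x 0) * (z 1 - x 1) - (y 1 - x 1) * (z 0 - x 0)

theorem mem_affineSpan_pair_of_orient_eq_zero {x y z : Plane} (hxy : x ≠ y)
    (h : orient x y z = 0) : z ∈ affineSpan ℝ {x, y} := by
  rw [mem_affineSpan_pair_iff_exists_lineMap_eq]
  unfold orient at h
  by_cases h0 : y 0 - x 0 = 0
  · have h1 : y 1 - x 1 ≠ 0 := fun h1 ↦ hxy <| by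
      ext i
      fin_cases i
      · exact (sub_eq_zero.1 h0).symm
      · exact (sub_eq_zero.1 h1).symm
    have hz : z 0 - x 0 = 0 := by
      simpa [h0, h1] using h
    refine ⟨(z 1 - x 1) / (y 1 - x 1), ?_⟩
    ext i
    fin_cases i
    · simp [AffineMap.lineMap_apply, h0]
      linarith
    · simp [AffineMap.lineMap_apply, h1]
  · refine ⟨(z 0 - x 0) / (y 0 - x 0), ?_⟩
    ext i
    fin_cases i
    · simp [AffineMap.lineMap_apply, h0]
    · simp [AffineMap.lineMap_apply]
      field_simp
      linarith

/-- Otherwise `orient p p'`, being affine in its last argument, vanishes somewhere on the segment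
from `q` to `q'`, giving a point of the hull of `Q` on the line through `p` and `p'`. -/
theorem Avoids.orient_mul_pos {P Q : Set Plane} (h : Avoids P Q) {p p' q q' : Plane}
    (hp : p ∈ P) (hp' : p' ∈ P) (hne : p ≠ p') (hq : q ∈ Q) (hq' : q' ∈ Q) :
    0 < orient p p' q * orient p p' q' := by
  by_contra! hle
  have hnot : ∀ t : ℝ, 0 ≤ t → t ≤ 1 →
      (1 - t) * orient p p' q + t * orient p p' q' ≠ 0 := by
    intro t ht0 ht1 h0
    refine Set.disjoint_left.1 (h p hp p' hp' hne)
      (mem_affineSpan_pair_of_orient_eq_zero (z := (1 - t) • q + t • q') hne ?_) ?_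
    · rw [← h0]
      simp only [orient, PiLp.add_apply, PiLp.smul_apply, smul_eq_mul]
      ring
    · exact convex_convexHull ℝ Q (subset_convexHull ℝ Q hq) (subset_convexHull ℝ Q hq')
        (by linarith) ht0 (by ring)
  generalize orient p p' q = u at *
  generalize orient p p' q' = v at *
  have hu : u ≠ 0 := by simpa using hnot 0 le_rfl zero_le_one
  have hv : v ≠ 0 := by simpa using hnot 1 zero_le_one le_rfl
  rcases hu.lt_or_gt with hu | hu
  · have hv : 0 < v := lt_of_le_of_ne (by nlinarith) hv.symm
    refine hnot (u / (u - v)) (div_nonneg_of_nonpos hu.le (by linarith))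
      ((div_le_one_of_neg (by linarith)).2 (by linarith)) ?_
    field_simp [show u - v ≠ 0 by linarith]
    ring
  · have hv : v < 0 := lt_of_le_of_ne (by nlinarith) hv
    refine hnot (u / (u - v)) (div_nonneg hu.le (by linarith))
      ((div_le_one (by linarith)).2 (by linarith)) ?_
    field_simp [show u - v ≠ 0 by linarith]
    ring

/-- Seen from the points of `Q`, the points of `P` are linearly ordered by direction, and the
order does not depend on the point of view. -/
theorem Avoids.exists_order {P Q : Set Plane} (hPQ : Avoids P Q) (hQP : Avoids Q P)
    (hQ : Q.Nontrivial) :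
    ∃ φ : Plane → ℝ, Set.InjOn φ P ∧
      ∀ p ∈ P, ∀ p' ∈ P, ∀ q ∈ Q, φ p < φ p' → 0 < orient p p' q := by
  obtain ⟨q₀, hq₀, q₁, hq₁, hq⟩ := hQ
  -- The quotient of `m p` by `orient q₀ q₁ p` is the cotangent of the angle from `q₁ - q₀` to `p -
  -- q₀`. Its negative serves as `φ`: it increases with the angle, as `P` lies on one side of the
  -- line `q₀ q₁`.
  set m : Plane → ℝ := fun p ↦
    (q₁ 0 - q₀ 0) * (p 0 - q₀ 0) + (q₁ 1 - q₀ 1) * (p 1 - q₀ 1) with hm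
  set d : ℝ := (q₁ 0 - q₀ 0) ^ 2 + (q₁ 1 - q₀ 1) ^ 2 with hd
  have hd0 : 0 < d := by
    refine lt_of_le_of_ne (by positivity) fun h0 ↦ hq ?_
    ext i
    fin_cases i
    · show q₀ 0 = q₁ 0
      nlinarith [sq_nonneg (q₁ 0 - q₀ 0), sq_nonneg (q₁ 1 - q₀ 1)]
    · show q₀ 1 = q₁ 1
      nlinarith [sq_nonneg (q₁ 0 - q₀ 0), sq_nonneg (q₁ 1 - q₀ 1)]
  have hne {p} (hp : p ∈ P) : orient q₀ q₁ p ≠ 0 := fun h0 ↦ by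
    have := hQP.orient_mul_pos hq₀ hq₁ hq hp hp
    simp [h0] at this
  have key {p p'} (hp : p ∈ P) (hp' : p' ∈ P) :
      (-(m p' / orient q₀ q₁ p') - -(m p / orient q₀ q₁ p)) *
        (orient q₀ q₁ p * orient q₀ q₁ p') = d * orient p p' q₀ := by
    have h := hne hp
    have h' := hne hp'
    field_simp
    simp only [orient, hm, hd]
    ring
  refine ⟨fun p ↦ -(m p / orient q₀ q₁ p), fun p hp p' hp' heq ↦ ?_,
    fun p hp p' hp' q hq' hlt ↦ ?_⟩
  · by_contra hpp
    have h₁ := hPQ.orient_mul_pos hp hp' hpp hq₀ hq₀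
    have h₂ := key hp hp'
    simp only at heq
    rw [heq, sub_self, zero_mul, zero_eq_mul] at h₂
    simp [h₂.resolve_left hd0.ne'] at h₁
  · have hpp : p ≠ p' := by
      rintro rfl
      exact lt_irrefl _ hlt
    -- The order is defined from `q₀`; avoidance of `Q` by `P` carries the sign over to every other
    -- viewpoint `q`.
    have h₁ := hPQ.orient_mul_pos hp hp' hpp hq₀ hq'
    have h₂ : 0 < d * orient p p' q₀ := by
      rw [← key hp hp']
      exact mul_pos (sub_pos.2 hlt) (hQP.orient_mul_pos hq₀ hq₁ hq hp hp')
    exact (pos_iff_pos_of_mul_pos h₁).1 (pos_of_mul_pos_right h₂ hd0.le)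

/-- If `c` is strictly between `a` and `b`, and `c'` between `a'` and `b'`, then `c'` cannot be
separated from both `a'` and `b'` by the line through `a` and `b`. -/
theorem not_orient_of_sbtw {a b c a' b' c' : Plane} (h : Sbtw ℝ a c b) (h' : Sbtw ℝ a' c' b')
    (ha : 0 < orient a' a b) (hb : 0 < orient b b' a) (hc : 0 < orient c' c a) : False := by
  obtain ⟨⟨t, ht, rfl⟩, hca, -⟩ := h
  obtain ⟨⟨s, hs, rfl⟩, -, -⟩ := h'
  have ht0 : 0 < t := lt_of_le_of_ne ht.1 fun h0 ↦ hca (by rw [← h0]; simp)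
  -- By `ha` and `hb`, both `a'` and `b'` lie to the left of the directed line from `a` to `b`,
  -- hence so does `c'`; but `hc` places it to the right.
  have h₁ : orient ((AffineMap.lineMap a' b') s) ((AffineMap.lineMap a b) t) a =
      - (t * ((1 - s) * orient a' a b + s * orient b b' a)) := by
    simp [orient, AffineMap.lineMap_apply]
    ring
  rw [h₁] at hc
  have h₂ : 0 ≤ (1 - s) * orient a' a b := mul_nonneg (by linarith [hs.2]) ha.le
  have h₃ : 0 ≤ s * orient b b' a := mul_nonneg hs.1 hb.le
  nlinarith [mul_nonneg ht0.le (add_nonneg h₂ h₃)]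

theorem Avoids.ne {P Q : Set Plane} (h : Avoids P Q) (hP : P.Nontrivial) {p q : Plane}
    (hp : p ∈ P) (hq : q ∈ Q) : p ≠ q := by
  rintro rfl
  obtain ⟨p', hp', hne⟩ := hP.exists_ne p
  exact Set.disjoint_left.1 (h p hp p' hp' hne.symm) (left_mem_affineSpan_pair ℝ p p')
    (subset_convexHull ℝ Q hq)

/-- Distinct `p` and `p'` on the line `q r` would span that line, which meets `Q` at `q`. -/
theorem Avoids.eq_of_collinear {P Q : Set Plane} (h : Avoids P Q) {p p' q r : Plane}
    (hp : p ∈ P) (hp' : p' ∈ P) (hq : q ∈ Q) (hqr : q ≠ r) (h₁ : Collinear ℝ {q, r, p})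
    (h₂ : Collinear ℝ {q, r, p'}) : p = p' := by
  by_contra hne
  have m₁ : p ∈ affineSpan ℝ {q, r} :=
    h₁.mem_affineSpan_of_mem_of_ne (by simp) (by simp) (by simp) hqr
  have m₂ : p' ∈ affineSpan ℝ {q, r} :=
    h₂.mem_affineSpan_of_mem_of_ne (by simp) (by simp) (by simp) hqr
  have hcol := collinear_insert_insert_of_mem_affineSpan_pair m₁ m₂
  exact Set.disjoint_left.1 (h p hp p' hp' hne)
    (hcol.mem_affineSpan_of_mem_of_ne (by simp) (by simp) (by simp) hne)
    (subset_convexHull ℝ Q hq)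

open SimpleGraph TripartiteFromTriangles in
/-- The collinear triples of mutually avoiding sets form a linear system. -/
theorem MutuallyAvoiding.explicitDisjoint {A B C : Set Plane} (h : MutuallyAvoiding A B C)
    (hA : A.Nontrivial) (hB : B.Nontrivial) {T : Finset (Plane × Plane × Plane)}
    (hT : ∀ t ∈ T, t.1 ∈ A ∧ t.2.1 ∈ B ∧ t.2.2 ∈ C ∧
      Collinear ℝ ({t.1, t.2.1, t.2.2} : Set Plane)) :
    ExplicitDisjoint T := by
  obtain ⟨⟨hAB, hAC⟩, ⟨hBA, hBC⟩, hCA, hCB⟩ := h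
  have perm₀ (a b c : Plane) : ({a, b, c} : Set Plane) = {b, c, a} := by ext; simp; tauto
  have perm₁ (a b c : Plane) : ({a, b, c} : Set Plane) = {a, c, b} := by ext; simp; tauto
  refine ⟨fun a b c a' h h' ↦ ?_, fun a b c b' h h' ↦ ?_, fun a b c c' h h' ↦ ?_⟩ <;>
    obtain ⟨ha, hb, hc, hcol⟩ := hT _ h <;> obtain ⟨ha', hb', hc', hcol'⟩ := hT _ h'
  · exact hAB.eq_of_collinear ha ha' hb (hBC.ne hB hb hc) (perm₀ .. ▸ hcol) (perm₀ .. ▸ hcol')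
  · exact hBA.eq_of_collinear hb hb' ha (hAC.ne hA ha hc) (perm₁ .. ▸ hcol) (perm₁ .. ▸ hcol')
  · exact hCA.eq_of_collinear hc hc' ha (hAB.ne hA ha hb) hcol hcol'

/-! ### From collinear triples to triples of ranks. -/

open Finset in
theorem exists_rank {α β : Type*} [LinearOrder β] (A : Finset α) (φ : α → β)
    (hφ : Set.InjOn φ A) :
    ∃ r : α → ℕ, Set.InjOn r A ∧ (∀ a ∈ A, r a < #A) ∧
      ∀ a ∈ A, ∀ a' ∈ A, r a < r a' → φ a < φ a' := by
  have hlt : ∀ a ∈ A, ∀ a' ∈ A, φ a < φ a' → #{x ∈ A | φ x < φ a} < #{x ∈ A | φ x < φ a'} := by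
    intro a ha a' ha' h
    refine card_lt_card ((ssubset_iff_of_subset fun x hx ↦ ?_).2 ⟨a, ?_, ?_⟩)
    · simp only [mem_filter] at hx ⊢
      exact ⟨hx.1, hx.2.trans h⟩
    · simp [ha, h]
    · simp
  refine ⟨fun a ↦ #{x ∈ A | φ x < φ a}, fun a ha a' ha' h ↦ ?_, fun a ha ↦ ?_,
    fun a ha a' ha' h ↦ ?_⟩
  · refine hφ ha ha' (le_antisymm ?_ ?_) <;> refine not_lt.1 fun hl ↦ ?_
    · exact (hlt _ ha' _ ha hl).ne' h
    · exact (hlt _ ha _ ha' hl).ne h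
  · exact card_lt_card ((ssubset_iff_of_subset (filter_subset _ _)).2 ⟨a, ha, by simp⟩)
  · by_contra! hle
    exact h.not_ge (card_le_card fun x hx ↦ by
      simp only [mem_filter] at hx ⊢
      exact ⟨hx.1, hx.2.trans_le hle⟩)

theorem ContainsTriangleProduct.of_image {α β γ α' β' γ' : Type*} [DecidableEq α']
    [DecidableEq β'] [DecidableEq γ'] {T : Finset (α × β × γ)} {f : α → α'} {g : β → β'}
    {h : γ → γ'} {A : Set α} {B : Set β} {C : Set γ} (hf : A.InjOn f) (hg : B.InjOn g)
    (hh : C.InjOn h) (hT : ∀ t ∈ T, t.1 ∈ A ∧ t.2.1 ∈ B ∧ t.2.2 ∈ C)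
    (H : ContainsTriangleProduct (T.image fun t ↦ (f t.1, g t.2.1, h t.2.2))) :
    ContainsTriangleProduct T := by
  obtain ⟨a, b, c, ⟨ha, hb, hc⟩, habc⟩ := H
  simp only [Finset.mem_image, Prod.mk.injEq] at habc
  choose w hwT hwa hwb hwc using habc
  have ind (k : Fin 3) (p : Fin 2) : ∃ s : Fin 3, (if s = k then 1 else 0 : Fin 2) = p := by
    revert k p; decide
  -- A coordinate value can come from several triples `w s t`; `σ` selects one, and injectivity of
  -- `f`, `g`, `h` makes the choice immaterial.
  choose σ hσ using ind
  have hA (p q) : f (w (σ 0 p) (σ 0 q)).1 = a p q := by rw [hwa, hσ, hσ]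
  have hB (p q) : g (w (σ 1 p) (σ 1 q)).2.1 = b p q := by rw [hwb, hσ, hσ]
  have hC (p q) : h (w (σ 2 p) (σ 2 q)).2.2 = c p q := by rw [hwc, hσ, hσ]
  refine ⟨fun p q ↦ (w (σ 0 p) (σ 0 q)).1, fun p q ↦ (w (σ 1 p) (σ 1 q)).2.1,
    fun p q ↦ (w (σ 2 p) (σ 2 q)).2.2, ⟨?_, ?_, ?_⟩, fun s t ↦ ?_⟩
  · intro p p' q q' e
    exact ha (by rw [← hA, ← hA]; exact congrArg f e)
  · intro p p' q q' e
    exact hb (by rw [← hB, ← hB]; exact congrArg g e)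
  · intro p p' q q' e
    exact hc (by rw [← hC, ← hC]; exact congrArg h e)
  · convert hwT s t using 1
    refine Prod.ext ?_ (Prod.ext ?_ ?_)
    · exact hf (hT _ (hwT _ _)).1 (hT _ (hwT _ _)).1 (by rw [hA, hwa])
    · exact hg (hT _ (hwT _ _)).2.1 (hT _ (hwT _ _)).2.1 (by rw [hB, hwb])
    · exact hh (hT _ (hwT _ _)).2.2 (hT _ (hwT _ _)).2.2 (by rw [hC, hwc])

theorem ContainsTriangleProduct.mono {α β γ : Type*} {S T : Finset (α × β × γ)}
    (h : ContainsTriangleProduct S) (hST : S ⊆ T) : ContainsTriangleProduct T :=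
  let ⟨a, b, c, hinj, habc⟩ := h
  ⟨a, b, c, hinj, fun s t ↦ hST (habc s t)⟩

theorem ContainsTriangleProduct.of_swap_right {α : Type*} [DecidableEq α]
    {T : Finset (α × α × α)}
    (h : ContainsTriangleProduct (T.image fun t ↦ (t.1, t.2.2, t.2.1))) :
    ContainsTriangleProduct T := by
  obtain ⟨a, b, c, ⟨ha, hb, hc⟩, habc⟩ := h
  refine ⟨a, c, b, ⟨ha, hc, hb⟩, fun s t ↦ ?_⟩
  obtain ⟨⟨x, y, z⟩, hx, he⟩ := Finset.mem_image.1 (habc (Equiv.swap 1 2 s) (Equiv.swap 1 2 t))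
  simp only [Prod.mk.injEq] at he
  have h₀ (s : Fin 3) : Equiv.swap 1 2 s = 0 ↔ s = 0 := by revert s; decide
  have h₁ (s : Fin 3) : Equiv.swap 1 2 s = 1 ↔ s = 2 := by revert s; decide
  have h₂ (s : Fin 3) : Equiv.swap 1 2 s = 2 ↔ s = 1 := by revert s; decide
  simp only [h₀, h₁, h₂] at he
  rwa [← he.1, ← he.2.1, ← he.2.2]

theorem ContainsTriangleProduct.of_swap_ends {α : Type*} [DecidableEq α]
    {T : Finset (α × α × α)}
    (h : ContainsTriangleProduct (T.image fun t ↦ (t.2.2, t.2.1, t.1))) :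
    ContainsTriangleProduct T := by
  obtain ⟨a, b, c, ⟨ha, hb, hc⟩, habc⟩ := h
  refine ⟨c, b, a, ⟨hc, hb, ha⟩, fun s t ↦ ?_⟩
  obtain ⟨⟨x, y, z⟩, hx, he⟩ := Finset.mem_image.1 (habc (Equiv.swap 0 2 s) (Equiv.swap 0 2 t))
  simp only [Prod.mk.injEq] at he
  have h₀ (s : Fin 3) : Equiv.swap 0 2 s = 0 ↔ s = 2 := by revert s; decide
  have h₁ (s : Fin 3) : Equiv.swap 0 2 s = 1 ↔ s = 1 := by revert s; decide
  have h₂ (s : Fin 3) : Equiv.swap 0 2 s = 2 ↔ s = 0 := by revert s; decide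
  simp only [h₀, h₁, h₂] at he
  rwa [← he.1, ← he.2.1, ← he.2.2]

open Finset SimpleGraph TripartiteFromTriangles in
theorem exists_containsTriangleProduct_of_sbtw {δ : ℝ} (hδ : 0 < δ) :
    ∃ N : ℕ, ∀ n, N ≤ n → ∀ A B C : Finset Plane, #A = n → #B = n → #C = n →
      MutuallyAvoiding (A : Set Plane) (B : Set Plane) (C : Set Plane) →
      ∀ T : Finset (Plane × Plane × Plane),
        (∀ t ∈ T, t.1 ∈ A ∧ t.2.1 ∈ B ∧ t.2.2 ∈ C ∧ Sbtw ℝ t.1 t.2.2 t.2.1) →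
        δ * (n : ℝ) ^ 2 ≤ #T → ContainsTriangleProduct T := by
  classical
  obtain ⟨N, hN⟩ := containsTriangleProduct_of_no_strict_chain hδ
  refine ⟨max N 2, fun n hn A B C hA hB hC hav T hT hcard ↦ ?_⟩
  have hnt {P : Finset Plane} (hP : #P = n) : (P : Set Plane).Nontrivial := by
    have := le_max_right N 2
    exact Finset.one_lt_card_iff_nontrivial.1 (by omega)
  have hlin : ExplicitDisjoint T := by
    refine hav.explicitDisjoint (hnt hA) (hnt hB) fun t ht ↦ ?_
    obtain ⟨h₁, h₂, h₃, h₄⟩ := hT t ht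
    refine ⟨h₁, h₂, h₃, ?_⟩
    rw [Set.pair_comm]
    exact h₄.wbtw.collinear
  obtain ⟨⟨hAB, hAC⟩, ⟨hBA, hBC⟩, hCA, hCB⟩ := hav
  obtain ⟨φ, hφ, hφ'⟩ := hAB.exists_order hBA (hnt hB)
  obtain ⟨χ, hχ, hχ'⟩ := hBA.exists_order hAB (hnt hA)
  obtain ⟨ψ, hψ, hψ'⟩ := hCA.exists_order hAC (hnt hA)
  -- The orders on `A` and `C` are reversed, that on `B` is not: with these signs a strict chain
  -- yields exactly the three orientations excluded by `not_orient_of_sbtw`.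
  obtain ⟨f, hf, hfn, hf'⟩ := exists_rank A (fun x ↦ -φ x) (neg_injective.comp_injOn hφ)
  obtain ⟨g, hg, hgn, hg'⟩ := exists_rank B χ hχ
  obtain ⟨h, hh, hhn, hh'⟩ := exists_rank C (fun x ↦ -ψ x) (neg_injective.comp_injOn hψ)
  rw [hA] at hfn
  rw [hB] at hgn
  rw [hC] at hhn
  have hinj : Set.InjOn (fun t : Plane × Plane × Plane ↦ (f t.1, g t.2.1, h t.2.2)) T := by
    intro t ht t' ht' heq
    have h₁ := hT t ht
    have h₂ := hT t' ht'
    simp only [Prod.mk.injEq] at heq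
    exact Prod.ext (hf h₁.1 h₂.1 heq.1)
      (Prod.ext (hg h₁.2.1 h₂.2.1 heq.2.1) (hh h₁.2.2.1 h₂.2.2.1 heq.2.2))
  refine ContainsTriangleProduct.of_image hf hg hh
    (fun t ht ↦ ⟨(hT t ht).1, (hT t ht).2.1, (hT t ht).2.2.1⟩)
    (hN n (le_trans (le_max_left _ _) hn) _ ?_ ?_ ?_ (by rwa [card_image_of_injOn hinj]))
  · intro t ht
    obtain ⟨t, htT, rfl⟩ := mem_image.1 ht
    have := hT t htT
    simp only [mem_product, mem_range]
    exact ⟨hfn _ this.1, hgn _ this.2.1, hhn _ this.2.2.1⟩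
  · refine ⟨fun a b c a' h₁ h₂ ↦ ?_, fun a b c b' h₁ h₂ ↦ ?_, fun a b c c' h₁ h₂ ↦ ?_⟩ <;>
      obtain ⟨⟨x, y, z⟩, ht, he⟩ := mem_image.1 h₁ <;>
      obtain ⟨⟨x', y', z'⟩, ht', he'⟩ := mem_image.1 h₂ <;>
      simp only [Prod.mk.injEq] at he he' <;>
      have h₁ := hT _ ht <;>
      have h₂ := hT _ ht'
    · obtain rfl := hg h₁.2.1 h₂.2.1 (he.2.1.trans he'.2.1.symm)
      obtain rfl := hh h₁.2.2.1 h₂.2.2.1 (he.2.2.trans he'.2.2.symm)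
      rw [← he.1, ← he'.1, hlin.inj₀ ht ht']
    · obtain rfl := hf h₁.1 h₂.1 (he.1.trans he'.1.symm)
      obtain rfl := hh h₁.2.2.1 h₂.2.2.1 (he.2.2.trans he'.2.2.symm)
      rw [← he.2.1, ← he'.2.1, hlin.inj₁ ht ht']
    · obtain rfl := hf h₁.1 h₂.1 (he.1.trans he'.1.symm)
      obtain rfl := hg h₁.2.1 h₂.2.1 (he.2.1.trans he'.2.1.symm)
      rw [← he.2.2, ← he'.2.2, hlin.inj₂ ht ht']
  · rintro s hs t ht ⟨h₁, h₂, h₃⟩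
    obtain ⟨s, hsT, rfl⟩ := mem_image.1 hs
    obtain ⟨t, htT, rfl⟩ := mem_image.1 ht
    obtain ⟨sA, sB, sC, hs⟩ := hT s hsT
    obtain ⟨tA, tB, tC, ht⟩ := hT t htT
    exact not_orient_of_sbtw hs ht
      (hφ' _ tA _ sA _ sB (neg_lt_neg_iff.1 (hf' _ sA _ tA h₁)))
      (hχ' _ sB _ tB _ sA (hg' _ sB _ tB h₂))
      (hψ' _ tC _ sC _ sA (neg_lt_neg_iff.1 (hh' _ sC _ tC h₃)))

-- One of the three sets supplies the middle point in at least a third of the triples; renaming the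
-- sets moves it to the third position.
open Finset in
theorem exists_containsTriangleProduct_of_collinear {δ : ℝ} (hδ : 0 < δ) :
    ∃ N : ℕ, ∀ n, N ≤ n → ∀ A B C : Finset Plane, #A = n → #B = n → #C = n →
      MutuallyAvoiding (A : Set Plane) (B : Set Plane) (C : Set Plane) →
      ∀ T : Finset (Plane × Plane × Plane),
        (∀ t ∈ T, t.1 ∈ A ∧ t.2.1 ∈ B ∧ t.2.2 ∈ C ∧
          Collinear ℝ ({t.1, t.2.1, t.2.2} : Set Plane)) →
        δ * (n : ℝ) ^ 2 ≤ #T → ContainsTriangleProduct T := by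
  classical
  obtain ⟨N, hN⟩ := exists_containsTriangleProduct_of_sbtw (δ := δ / 3) (by positivity)
  refine ⟨max N 2, fun n hn A B C hA hB hC hav T hT hcard ↦ ?_⟩
  have hNn : N ≤ n := (le_max_left _ _).trans hn
  have hnt {P : Finset Plane} (hP : #P = n) : (P : Set Plane).Nontrivial := by
    have := le_max_right N 2
    exact Finset.one_lt_card_iff_nontrivial.1 (by omega)
  set T₁ := {t ∈ T | Sbtw ℝ t.1 t.2.2 t.2.1} with hT₁
  set T₂ := {t ∈ T | Sbtw ℝ t.1 t.2.1 t.2.2} with hT₂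
  set T₃ := {t ∈ T | Sbtw ℝ t.2.2 t.1 t.2.1} with hT₃
  have hcover : T ⊆ T₁ ∪ T₂ ∪ T₃ := by
    intro t ht
    obtain ⟨ha, hb, hc, hcol⟩ := hT t ht
    have hab := hav.1.1.ne (hnt hA) ha hb
    have hac := hav.1.2.ne (hnt hA) ha hc
    have hbc := hav.2.1.2.ne (hnt hB) hb hc
    simp only [mem_union, hT₁, hT₂, hT₃, mem_filter, ht, true_and]
    rcases hcol.wbtw_or_wbtw_or_wbtw with h | h | h
    · exact .inl (.inr ⟨h, hab.symm, hbc⟩)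
    · exact .inl (.inl ⟨h.symm, hac.symm, hbc.symm⟩)
    · exact .inr ⟨h, hac, hab⟩
  have hsum : #T ≤ #T₁ + #T₂ + #T₃ := (card_le_card hcover).trans
    ((card_union_le _ _).trans (Nat.add_le_add_right (card_union_le _ _) _))
  have hsum' : (#T : ℝ) ≤ #T₁ + #T₂ + #T₃ := by exact_mod_cast hsum
  obtain h | h | h : δ / 3 * (n : ℝ) ^ 2 ≤ #T₁ ∨ δ / 3 * (n : ℝ) ^ 2 ≤ #T₂ ∨
      δ / 3 * (n : ℝ) ^ 2 ≤ #T₃ := by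
    by_contra! hlt
    linarith [hlt.1, hlt.2.1, hlt.2.2]
  · refine (hN n hNn A B C hA hB hC hav T₁ (fun t ht ↦ ?_) h).mono (filter_subset _ _)
    obtain ⟨ht, hs⟩ := mem_filter.1 ht
    exact ⟨(hT t ht).1, (hT t ht).2.1, (hT t ht).2.2.1, hs⟩
  · refine (hN n hNn A C B hA hC hB ⟨⟨hav.1.2, hav.1.1⟩, hav.2.2, hav.2.1⟩
      (T₂.image fun t ↦ (t.1, t.2.2, t.2.1)) (fun t ht ↦ ?_) ?_).of_swap_right.mono
      (filter_subset _ _)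
    · obtain ⟨t, ht', rfl⟩ := mem_image.1 ht
      obtain ⟨htT, hs⟩ := mem_filter.1 ht'
      exact ⟨(hT t htT).1, (hT t htT).2.2.1, (hT t htT).2.1, hs⟩
    · rwa [card_image_of_injective]
      rintro ⟨a, b, c⟩ ⟨a', b', c'⟩ he
      simp_all
  · refine (hN n hNn C B A hC hB hA
      ⟨⟨hav.2.2.2, hav.2.2.1⟩, ⟨hav.2.1.2, hav.2.1.1⟩, hav.1.2, hav.1.1⟩
      (T₃.image fun t ↦ (t.2.2, t.2.1, t.1)) (fun t ht ↦ ?_) ?_).of_swap_ends.mono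
      (filter_subset _ _)
    · obtain ⟨t, ht', rfl⟩ := mem_image.1 ht
      obtain ⟨htT, hs⟩ := mem_filter.1 ht'
      exact ⟨(hT t htT).2.2.1, (hT t htT).2.1, (hT t htT).1, hs⟩
    · rwa [card_image_of_injective]
      rintro ⟨a, b, c⟩ ⟨a', b', c'⟩ he
      simp_all

/-! ### The tic-tac-toe inside a product of two triangles. -/

open Finset in
/-- The product of two triangles is a `(12, 9)` configuration that contains a tic-tac-toe. -/
theorem ContainsTriangleProduct.exists_ticTacToe {V : Type*} {A B C : Set V}
    {T : Finset (V × V × V)} (hT : ∀ t ∈ T, t.1 ∈ A ∧ t.2.1 ∈ B ∧ t.2.2 ∈ C)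
    (hAB : Disjoint A B) (hAC : Disjoint A C) (hBC : Disjoint B C)
    (h : ContainsTriangleProduct T) :
    ∃ S ⊆ T, #S = 9 ∧ #(verticesOf S) = 12 ∧ ContainsTicTacToe S := by
  classical
  obtain ⟨a, b, c, ⟨ha, hb, hc⟩, habc⟩ := h
  let ι (k s : Fin 3) : Fin 2 := if s = k then 1 else 0
  let v (x : Fin 3 × Fin 2 × Fin 2) : V := (![a, b, c] x.1) x.2.1 x.2.2
  let e (x : Fin 3 × Fin 3) : V × V × V :=
    (a (ι 0 x.1) (ι 0 x.2), b (ι 1 x.1) (ι 1 x.2), c (ι 2 x.1) (ι 2 x.2))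
  let I (x : Fin 3 × Fin 3) : Finset (Fin 3 × Fin 2 × Fin 2) :=
    {(0, ι 0 x.1, ι 0 x.2), (1, ι 1 x.1, ι 1 x.2), (2, ι 2 x.1, ι 2 x.2)}
  have heT (x) : e x ∈ T := habc x.1 x.2
  have hedge (x) : edgeOf (e x) = (I x).image v := by
    simp [edgeOf, e, I, v, image_insert]
  have hsurj (k : Fin 3) (p : Fin 2) : ∃ s, ι k s = p := by
    revert k p; decide
  have hvA (p q) : a p q ∈ A := by
    obtain ⟨s, rfl⟩ := hsurj 0 p
    obtain ⟨t, rfl⟩ := hsurj 0 q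
    exact (hT _ (heT (s, t))).1
  have hvB (p q) : b p q ∈ B := by
    obtain ⟨s, rfl⟩ := hsurj 1 p
    obtain ⟨t, rfl⟩ := hsurj 1 q
    exact (hT _ (heT (s, t))).2.1
  have hvC (p q) : c p q ∈ C := by
    obtain ⟨s, rfl⟩ := hsurj 2 p
    obtain ⟨t, rfl⟩ := hsurj 2 q
    exact (hT _ (heT (s, t))).2.2
  have hv : Function.Injective v := by
    have hab (p q p' q') : a p q ≠ b p' q' := hAB.ne_of_mem (hvA _ _) (hvB _ _)
    have hac (p q p' q') : a p q ≠ c p' q' := hAC.ne_of_mem (hvA _ _) (hvC _ _)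
    have hbc (p q p' q') : b p q ≠ c p' q' := hBC.ne_of_mem (hvB _ _) (hvC _ _)
    rintro ⟨k, p, q⟩ ⟨k', p', q'⟩ heq
    fin_cases k <;> fin_cases k' <;> simp only [v] at heq
    · obtain ⟨rfl, rfl⟩ := ha heq; rfl
    · exact (hab _ _ _ _ heq).elim
    · exact (hac _ _ _ _ heq).elim
    · exact (hab _ _ _ _ heq.symm).elim
    · obtain ⟨rfl, rfl⟩ := hb heq; rfl
    · exact (hbc _ _ _ _ heq).elim
    · exact (hac _ _ _ _ heq.symm).elim
    · exact (hbc _ _ _ _ heq.symm).elim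
    · obtain ⟨rfl, rfl⟩ := hc heq; rfl
  have he : Function.Injective e := by
    have hI : Function.Injective I := by decide
    exact fun x y hxy ↦ hI (image_injective hv (by rw [← hedge, ← hedge, hxy]))
  refine ⟨univ.image e, image_subset_iff.2 fun x _ ↦ heT x, ?_, ?_, ?_⟩
  · rw [card_image_of_injective _ he]
    rfl
  · have : verticesOf (univ.image e) = univ.image v := by
      have hI : univ.biUnion I = univ := by decide
      rw [verticesOf, image_biUnion, ← hI, biUnion_image]
      exact biUnion_congr rfl fun x _ ↦ by convert hedge x
    rw [this, card_image_of_injective _ hv]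
    rfl
  -- The board omits the three vertices with both levels equal to `1`. Its lines are the triples
  -- `(s, t)` with `s ≠ t`: rows have `t = s + 1` and columns `t = s - 1` modulo `3`.
  · let g : Fin 3 → Fin 3 → Fin 3 × Fin 2 × Fin 2 :=
      ![![(2, 0, 0), (1, 0, 1), (0, 1, 0)], ![(1, 1, 0), (0, 0, 0), (2, 0, 1)],
        ![(0, 0, 1), (2, 1, 0), (1, 0, 0)]]
    have hg : ∀ x y : Fin 3 × Fin 3, g x.1 x.2 = g y.1 y.2 → x = y := by decide
    refine ⟨fun i j ↦ v (g i j), fun i i' j j' h ↦ by simpa using hg (i, j) (i', j') (hv h),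
      fun i ↦ ?_, fun j ↦ ?_⟩
    · have hrow : ∀ i, ∃ x, I x = {g i 0, g i 1, g i 2} := by decide
      obtain ⟨x, hx⟩ := hrow i
      refine ⟨e x, mem_image_of_mem e (mem_univ x), ?_⟩
      rw [hedge, hx]
      simp [image_insert]
    · have hcol : ∀ j, ∃ x, I x = {g 0 j, g 1 j, g 2 j} := by decide
      obtain ⟨x, hx⟩ := hcol j
      refine ⟨e x, mem_image_of_mem e (mem_univ x), ?_⟩
      rw [hedge, hx]
      simp [image_insert]

/-- `T` is any selected family of collinear triples; the family of all collinear triples is the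
special case in which `T` is as large as possible. -/
theorem theorem2p1 (δ : ℝ) (hδ : 0 < δ) :
    ∃ n₀ : ℕ, ∀ n : ℕ, n₀ ≤ n → ∀ A B C : Finset Plane,
      A.card = n → B.card = n → C.card = n →
      MutuallyAvoiding (A : Set Plane) (B : Set Plane) (C : Set Plane) →
      ∀ T : Finset (Plane × Plane × Plane),
        (∀ t ∈ T, t.1 ∈ A ∧ t.2.1 ∈ B ∧ t.2.2 ∈ C ∧
          Collinear ℝ ({t.1, t.2.1, t.2.2} : Set Plane)) →
        δ * (n : ℝ) ^ 2 ≤ (T.card : ℝ) →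
        ∃ S : Finset (Plane × Plane × Plane), S ⊆ T ∧
          S.card = 9 ∧ (verticesOf S).card = 12 ∧ ContainsTicTacToe S := by
  obtain ⟨N, hN⟩ := exists_containsTriangleProduct_of_collinear hδ
  refine ⟨max N 2, fun n hn A B C hA hB hC hav T hT hcard ↦ ?_⟩
  have hnt {P : Finset Plane} (hP : P.card = n) : (P : Set Plane).Nontrivial := by
    have := le_max_right N 2
    exact Finset.one_lt_card_iff_nontrivial.1 (by omega)
  exact (hN n ((le_max_left _ _).trans hn) A B C hA hB hC hav T hT hcard).exists_ticTacToe
    (A := A) (B := B) (C := C) (fun t ht ↦ ⟨(hT t ht).1, (hT t ht).2.1, (hT t ht).2.2.1⟩)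
    (Set.disjoint_left.2 fun x hx hx' ↦ hav.1.1.ne (hnt hA) hx hx' rfl)
    (Set.disjoint_left.2 fun x hx hx' ↦ hav.1.2.ne (hnt hA) hx hx' rfl)
    (Set.disjoint_left.2 fun x hx hx' ↦ hav.2.1.2.ne (hnt hB) hx hx' rfl)
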